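/- **Setting.** For an undirected graph $G$ on $N\ge 1$ nodes let $L=D-A=Q\,\mathrm{diag}(\ell_1,\dots,\ell_N)\,Q^\top$ be its unnormalized Laplacian, with $\ell_1\le\dots\le \ell_N$ and $Q$ orthogonal. For $\lambda>0$ put $\Lambda=\mathrm{diag}(\lambda_1,\dots,\lambda_N)$ with $\lambda_k=\ell_k+\lambda$, and $\|\alpha\|_\Lambda=\sqrt{\alpha^\top\Lambda\alpha}$. Given $T$ and $\lambda$, the effective dimension of $G$ is the largest $d\ge 1$ (with $d<N$) such that $(d-1)\lambda_d\le \frac{T}{\log(T/\lambda+1)}<d\,\lambda_{d+1}$. A parameter $\alpha\in\mathbb R^N$ gives node rewards $f_\alpha=Q\alpha$. The arms of $G$ form a set $\mathcal S_D$ of probes that contains the indicator vector of every single node and in which every probe is the uniform probability vector on some node together with some (possibly none) of its neighbors; a probe $s$ has mean reward $F_G(s)=s^\top Q\alpha$. A policy $\pi$ is a (possibly randomized) rule that, for each graph $G$, chooses the probe $\pi(t)\in\mathcal S_D$ from the past probes and past observed rewards; playing $s$ yields the observation $F_G(s)+\varepsilon_t$ with independent noise $\varepsilon_t\sim N(0,R^2)$.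 Its expected cumulative regret is $\mathrm{Regret}(T,\pi,\alpha,G)=\mathbb E\big[\sum_{t=1}^T\big(\max_{s\in\mathcal S_D}F_G(s)-F_G(\pi(t))\big)\big]$. **Proposition.** There is a universal constant $\kappa>0$ with the following property. Let $d\ge 2$ and $T\ge 1$ be integers and let $R,c,\lambda>0$ be such that $(d-1)\lambda\le \frac{T}{\log(T/\lambda+1)}$ and $\lambda\, d R^2\le c^2T$ (both hold whenever $\lambda$ is small enough in terms of $d,T,R,c$, and, for fixed $d,R,c,\lambda$, whenever $T$ is large enough). Fix for every finite graph a decomposition of its Laplacian and a set of arms $\mathcal S_D$ as above. Then for every policy $\pi$ there exist a graph $G$ of effective dimension $d$, which is a disjoint union of exactly $d$ cliques (single nodes count as cliques), and a parameter $\alpha^*$ whose coordinates after the first $d$ are all zero (so $\alpha^*\in\mathbb R^d$), whose reward function $f_{\alpha^*}$ is constant on each clique, and which is smooth, $\|\alpha^*\|_\Lambda\le c$, such that $$\mathrm{Regret}(T,\pi,\alpha^*,G)\ \ge\ \kappa\, R\,\sqrt{dT}.$$ -/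

import Mathlib

open MeasureTheory ProbabilityTheory
open scoped Matrix

namespace SpectralBandit

/-! ### Graph Laplacians and effective dimension -/

/-- The unnormalized Laplacian `L = D - A` of an undirected graph on `N` nodes. -/
noncomputable def laplacian {N : ℕ} (G : SimpleGraph (Fin N)) : Matrix (Fin N) (Fin N) ℝ := by
  classical exact G.lapMatrix ℝ

/-- An eigendecomposition `L = Q diag(ev) Qᵀ` of the Laplacian, with the eigenvalues (counted with
multiplicity) in nondecreasing order and the eigenvectors as the orthonormal columns of `Q`. -/
structure LaplacianSpectrum {N : ℕ} (G : SimpleGraph (Fin N)) where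
  ev : Fin N → ℝ
  Q : Matrix (Fin N) (Fin N) ℝ
  ev_monotone : Monotone ev
  Q_orthonormal : Qᵀ * Q = 1
  laplacian_eq : laplacian G = Q * Matrix.diagonal ev * Qᵀ

/-- Every finite graph has such a decomposition. -/
theorem LaplacianSpectrum.nonempty {N : ℕ} (G : SimpleGraph (Fin N)) :
    Nonempty (LaplacianSpectrum G) := by
  classical
  have hA : (laplacian G).IsHermitian := by
    unfold laplacian
    exact SimpleGraph.isHermitian_lapMatrix ℝ G
  set U : Matrix (Fin N) (Fin N) ℝ := (hA.eigenvectorUnitary : Matrix (Fin N) (Fin N) ℝ) with hU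
  have hU1 : Uᵀ * U = 1 := by
    have h := Matrix.mem_unitaryGroup_iff'.1 hA.eigenvectorUnitary.2
    rwa [Matrix.star_eq_conjTranspose, Matrix.conjTranspose_eq_transpose_of_trivial] at h
  have hspec : laplacian G = U * Matrix.diagonal hA.eigenvalues * Uᵀ := by
    have h := hA.spectral_theorem
    rw [Unitary.conjStarAlgAut_apply] at h
    rw [Matrix.star_eq_conjTranspose, Matrix.conjTranspose_eq_transpose_of_trivial] at h
    exact h
  let σ : Equiv.Perm (Fin N) := Tuple.sort hA.eigenvalues
  refine ⟨⟨hA.eigenvalues ∘ σ, U.submatrix id σ, Tuple.monotone_sort _, ?_, ?_⟩⟩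
  · rw [Matrix.transpose_submatrix, ← Matrix.submatrix_mul _ _ _ _ _ Function.bijective_id, hU1]
    exact Matrix.submatrix_one_equiv σ
  · refine hspec.trans ?_
    ext i j
    rw [Matrix.mul_apply, Matrix.mul_apply]
    simp only [Matrix.mul_diagonal, Matrix.transpose_apply, Matrix.submatrix_apply, id,
      Function.comp]
    exact (Equiv.sum_comp σ (fun k => U i k * hA.eigenvalues k * U j k)).symm

/-- `d` is the effective dimension for horizon `T` and regularization `lam`: the largest `k` with
`(k - 1) λ_k ≤ T / log (T / lam + 1) < k λ_{k+1}`, where `λ_1 ≤ … ≤ λ_N` are the diagonal elements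
of `Λ = diag(ev) + lam I`. Indices of `ev` start at `0`, so `λ_k = ev (k - 1) + lam`. -/
def IsEffectiveDimension {N : ℕ} (ev : Fin N → ℝ) (lam : ℝ) (T d : ℕ) : Prop :=
  IsGreatest {k : ℕ | 1 ≤ k ∧ ∃ hk : k < N,
    ((k : ℝ) - 1) * (ev ⟨k - 1, by omega⟩ + lam) ≤ (T : ℝ) / Real.log ((T : ℝ) / lam + 1) ∧
    (T : ℝ) / Real.log ((T : ℝ) / lam + 1) < (k : ℝ) * (ev ⟨k, hk⟩ + lam)} d

/-- The norm `‖α‖_Λ = √(αᵀ Λ α)` with `Λ = diag(ev) + lam I`. -/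
noncomputable def lambdaNorm {N : ℕ} (ev : Fin N → ℝ) (lam : ℝ) (α : Fin N → ℝ) : ℝ :=
  √(α ⬝ᵥ ((Matrix.diagonal ev + lam • (1 : Matrix (Fin N) (Fin N) ℝ)) *ᵥ α))

/-- `G` is the disjoint union of exactly `d` cliques. -/
def IsDisjointUnionOfCliques {N : ℕ} (G : SimpleGraph (Fin N)) (d : ℕ) : Prop :=
  (∀ u v, G.Reachable u v → u ≠ v → G.Adj u v) ∧ Nat.card G.ConnectedComponent = d

/-! ### Probes and rewards -/

/-- The probe with uniform weights on the node set `A`. -/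
noncomputable def uniformProbe {N : ℕ} (A : Finset (Fin N)) : Fin N → ℝ :=
  fun k => if k ∈ A then 1 / (A.card : ℝ) else 0

/-- `S` is an admissible set of arms on `G`: it contains all probes of single nodes, and each of its
elements averages uniformly over a node and some (possibly none) of its neighbors. -/
def IsProbeSet {N : ℕ} (G : SimpleGraph (Fin N)) (S : Set (Fin N → ℝ)) : Prop :=
  (∀ i, uniformProbe {i} ∈ S) ∧
  ∀ s ∈ S, ∃ (i : Fin N) (A : Finset (Fin N)), (∀ j ∈ A, G.Adj i j) ∧ s = uniformProbe (insert i A)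

/-- The reward function on the nodes, `f_α = Q α`. -/
def nodeReward {N : ℕ} (Q : Matrix (Fin N) (Fin N) ℝ) (α : Fin N → ℝ) : Fin N → ℝ :=
  Q *ᵥ α

/-- The mean reward `F_G(s) = sᵀ Q α` of the probe `s`. -/
def probeReward {N : ℕ} (Q : Matrix (Fin N) (Fin N) ℝ) (α : Fin N → ℝ) (s : Fin N → ℝ) : ℝ :=
  s ⬝ᵥ nodeReward Q α

theorem measurable_probeReward {N : ℕ} (Q : Matrix (Fin N) (Fin N) ℝ) (α : Fin N → ℝ) :
    Measurable (probeReward Q α) := by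
  unfold probeReward dotProduct
  fun_prop

/-! ### Policies and regret -/

/-- A (possibly randomized) policy with set of arms `S`: at each step it draws the next probe from a
distribution that depends measurably on the past probes and the past observed rewards. -/
structure Policy {N : ℕ} (S : Set (Fin N → ℝ)) where
  act : ∀ t : ℕ, Kernel (Fin t → S × ℝ) S
  isMarkov : ∀ t, IsMarkovKernel (act t)

/-- The observation `r = F_G(s) + ε` for the probe `s`, with noise `ε` of law `N(0, R²)`. -/
noncomputable def observation {N : ℕ} (Q : Matrix (Fin N) (Fin N) ℝ) (α : Fin N → ℝ) (R : ℝ)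
    (S : Set (Fin N → ℝ)) : Kernel S ℝ :=
  (Kernel.id ×ₖ Kernel.const S (gaussianReal 0 (Real.toNNReal (R ^ 2)))).map
    (fun p : S × ℝ => probeReward Q α p.1 + p.2)

instance {N : ℕ} (Q : Matrix (Fin N) (Fin N) ℝ) (α : Fin N → ℝ) (R : ℝ)
    (S : Set (Fin N → ℝ)) : IsMarkovKernel (observation Q α R S) := by
  unfold observation
  refine Kernel.IsMarkovKernel.map _ ?_
  exact ((measurable_probeReward Q α).comp (measurable_subtype_coe.comp measurable_fst)).add
    measurable_snd

/-- The law of the history (probes and observed rewards) of the first `t` steps: at each step the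
policy draws a probe given the past, and then a reward is observed with fresh noise. -/
noncomputable def historyLaw {N : ℕ} (Q : Matrix (Fin N) (Fin N) ℝ) (α : Fin N → ℝ) (R : ℝ)
    {S : Set (Fin N → ℝ)} (π : Policy S) : (t : ℕ) → Measure (Fin t → S × ℝ)
  | 0 => Measure.dirac Fin.elim0
  | t + 1 =>
    (historyLaw Q α R π t ⊗ₘ
        (π.act t ⊗ₖ Kernel.prodMkLeft (Fin t → S × ℝ) (observation Q α R S))).map
      (fun p => Fin.snoc (α := fun _ => S × ℝ) p.1 p.2)

theorem measurable_snoc {X : Type*} [MeasurableSpace X] (t : ℕ) :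
    Measurable (fun p : (Fin t → X) × X => (Fin.snoc (α := fun _ => X) p.1 p.2 : Fin (t + 1) → X)) := by
  refine measurable_pi_lambda _ fun i => ?_
  induction i using Fin.lastCases with
  | last => simpa using measurable_snd
  | cast i =>
    simp only [Fin.snoc_castSucc]
    exact (measurable_pi_apply i).comp measurable_fst

instance {N : ℕ} (Q : Matrix (Fin N) (Fin N) ℝ) (α : Fin N → ℝ) (R : ℝ)
    {S : Set (Fin N → ℝ)} (π : Policy S) (t : ℕ) : IsProbabilityMeasure (historyLaw Q α R π t) := by
  induction t with
  | zero => unfold historyLaw; infer_instance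
  | succ t ih =>
    unfold historyLaw
    have := π.isMarkov t
    exact Measure.isProbabilityMeasure_map (measurable_snoc t).aemeasurable

/-- The expected cumulative regret `E[∑_{t < T} (max_{s ∈ S} F_G(s) - F_G(π(t)))]`. (The sets of arms
in use are finite and nonempty, so that the supremum is a maximum.) -/
noncomputable def expectedRegret {N : ℕ} (Q : Matrix (Fin N) (Fin N) ℝ) (α : Fin N → ℝ) (R : ℝ)
    {S : Set (Fin N → ℝ)} (π : Policy S) (T : ℕ) : ℝ :=
  ∫ h, ∑ t : Fin T, ((⨆ s : S, probeReward Q α s) - probeReward Q α (h t).1)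
    ∂(historyLaw Q α R π T)

end SpectralBandit

open SpectralBandit

/-! One graph defeats every policy: `K = d - 1` isolated nodes together with a clique on `m` nodes,
`m` large. Its Laplacian has eigenvalue `0` with multiplicity `d` and `m` with multiplicity `m - 1`
(`ev_eq`), so `d` is the effective dimension as soon as `m` exceeds `T / log (T / lam + 1)`. A
reward function supported on one isolated node lies in the kernel of the Laplacian; hence its
spectral coordinates after the first `d` vanish, and its `Λ`-norm is `√lam` times its Euclidean
norm, whichever eigenbasis was fixed.

An isolated node has no neighbors, so only its own probe sees a signal placed on it
(`dotProduct_signal`). This leaves a bandit with `K` informative arms, while clique probes always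
earn `0`. Without signal, some node `i` is played at most `T / K` times on average. Put `δ` or `-δ`
on it: with `n` plays of `i` the regret is `δ (T - n)` in the first case and `δ n` in the second,
and with `δ` of order `R √(K / T)` the policy can hardly tell either case from the absence of
signal. So one of the two regrets is of order `δ T`. The two signs make the argument work even for
`K = 1`, where averaging over nodes gives nothing.

The comparison (`two_point_bound`) writes both laws through their likelihood ratios against the
signal-free law and uses `exp x ≥ 1 + x`; only the second moment of the observed reward sum is then
needed. -/

namespace SpectralBandit

open scoped ENNReal NNReal

/-! ### Likelihood ratios and the two-point comparison -/

section ChangeOfMeasure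

variable {N : ℕ} {S : Set (Fin N → ℝ)}

theorem observation_apply (Q : Matrix (Fin N) (Fin N) ℝ) (α : Fin N → ℝ) (R : ℝ) (s : S) :
    observation Q α R S s = gaussianReal (probeReward Q α s) (Real.toNNReal (R ^ 2)) := by
  have hm : Measurable (fun p : S × ℝ => probeReward Q α p.1 + p.2) :=
    ((measurable_probeReward Q α).comp (measurable_subtype_coe.comp measurable_fst)).add
      measurable_snd
  rw [observation, Kernel.map_apply _ hm, Kernel.prod_apply, Kernel.id_apply, Kernel.const_apply,
    Measure.dirac_prod, Measure.map_map hm (by fun_prop)]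
  have := gaussianReal_map_const_add (μ := 0) (v := Real.toNNReal (R ^ 2)) (probeReward Q α s)
  rw [zero_add] at this
  exact this

theorem lintegral_historyLaw_succ (Q : Matrix (Fin N) (Fin N) ℝ) (α : Fin N → ℝ) (R : ℝ)
    (π : Policy S) (t : ℕ) {F : (Fin (t + 1) → S × ℝ) → ℝ≥0∞} (hF : Measurable F) :
    ∫⁻ h, F h ∂historyLaw Q α R π (t + 1) =
      ∫⁻ h, ∫⁻ s, ∫⁻ r, F (Fin.snoc (α := fun _ => S × ℝ) h (s, r))
        ∂gaussianReal (probeReward Q α s) (Real.toNNReal (R ^ 2)) ∂π.act t h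
        ∂historyLaw Q α R π t := by
  have := π.isMarkov t
  have hF' : Measurable fun p : (Fin t → S × ℝ) × S × ℝ =>
      F (Fin.snoc (α := fun _ => S × ℝ) p.1 p.2) := hF.comp (measurable_snoc t)
  rw [historyLaw, lintegral_map hF (measurable_snoc t), Measure.lintegral_compProd hF']
  refine lintegral_congr fun h => ?_
  refine (Kernel.lintegral_compProd _ _ _ (hF'.comp measurable_prodMk_left)).trans ?_
  refine lintegral_congr fun s => ?_
  rw [Kernel.prodMkLeft_apply, observation_apply]
  rfl

theorem gaussianReal_eq_withDensity {v : ℝ≥0} (hv : v ≠ 0) (μ : ℝ) :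
    gaussianReal μ v = (gaussianReal 0 v).withDensity
      (fun x => ENNReal.ofReal (Real.exp (μ / v * x - μ ^ 2 / (2 * v)))) := by
  rw [gaussianReal_of_var_ne_zero _ hv, gaussianReal_of_var_ne_zero _ hv,
    ← withDensity_mul _ (measurable_gaussianPDF _ _) (by fun_prop)]
  congr 1
  ext x
  have hv' : (v : ℝ) ≠ 0 := by exact_mod_cast hv
  rw [Pi.mul_apply, gaussianPDF, gaussianPDF, ← ENNReal.ofReal_mul (gaussianPDFReal_nonneg _ _ _),
    gaussianPDFReal, gaussianPDFReal, mul_assoc _ (Real.exp _), ← Real.exp_add]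
  congr 3
  field_simp
  ring

theorem lintegral_gaussianReal_eq {v : ℝ≥0} (hv : v ≠ 0) (μ : ℝ) {F : ℝ → ℝ≥0∞}
    (hF : Measurable F) :
    ∫⁻ x, F x ∂gaussianReal μ v =
      ∫⁻ x, ENNReal.ofReal (Real.exp (μ / v * x - μ ^ 2 / (2 * v))) * F x ∂gaussianReal 0 v := by
  rw [gaussianReal_eq_withDensity hv, lintegral_withDensity_eq_lintegral_mul _ (by fun_prop) hF]
  rfl

theorem lintegral_sq_add_mul_gaussianReal (v : ℝ≥0) (a b : ℝ) :
    ∫⁻ x, ENNReal.ofReal ((a + b * x) ^ 2) ∂gaussianReal 0 v =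
      ENNReal.ofReal (a ^ 2) + ENNReal.ofReal (b ^ 2 * v) := by
  have h1 : Integrable (fun x : ℝ => x) (gaussianReal 0 v) :=
    (memLp_id_gaussianReal 1).integrable le_rfl
  have h2 : Integrable (fun x : ℝ => x ^ 2) (gaussianReal 0 v) :=
    (memLp_id_gaussianReal 2).integrable_sq
  have e : (fun x : ℝ => (a + b * x) ^ 2) =
      fun x => (a ^ 2 + 2 * a * b * x) + b ^ 2 * x ^ 2 := by
    ext x; ring
  have hi1 : Integrable (fun x : ℝ => a ^ 2 + 2 * a * b * x) (gaussianReal 0 v) :=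
    (integrable_const _).add (h1.const_mul _)
  have hi : Integrable (fun x : ℝ => (a + b * x) ^ 2) (gaussianReal 0 v) := by
    rw [e]; exact hi1.add (h2.const_mul _)
  have hsq : ∫ x, x ^ 2 ∂gaussianReal 0 v = v := by
    have := variance_of_integral_eq_zero (X := fun x : ℝ => x) (μ := gaussianReal 0 v)
      aemeasurable_id integral_id_gaussianReal
    rw [← this, variance_fun_id_gaussianReal]
  rw [← ofReal_integral_eq_lintegral_ofReal hi (ae_of_all _ fun x => sq_nonneg _), e,
    integral_add hi1 (h2.const_mul _), integral_add (integrable_const _) (h1.const_mul _),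
    integral_const_mul, integral_const_mul, hsq, integral_id_gaussianReal,
    ← ENNReal.ofReal_add (sq_nonneg a) (by positivity)]
  simp

/-- The number of plays of arms in `A`. -/
noncomputable def playCount (A : Set S) {t : ℕ} (h : Fin t → S × ℝ) : ℝ :=
  ∑ j, A.indicator 1 (h j).1

/-- The sum of the rewards observed on arms in `A`. -/
noncomputable def rewardSum (A : Set S) {t : ℕ} (h : Fin t → S × ℝ) : ℝ :=
  ∑ j, A.indicator 1 (h j).1 * (h j).2

theorem measurable_playCount {A : Set S} (hA : MeasurableSet A) (t : ℕ) :
    Measurable (playCount A (t := t)) := by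
  unfold playCount
  have : Measurable (A.indicator (1 : S → ℝ)) := measurable_one.indicator hA
  fun_prop

theorem measurable_rewardSum {A : Set S} (hA : MeasurableSet A) (t : ℕ) :
    Measurable (rewardSum A (t := t)) := by
  unfold rewardSum
  have : Measurable (A.indicator (1 : S → ℝ)) := measurable_one.indicator hA
  fun_prop

theorem indicator_one_nonneg (A : Set S) (s : S) : 0 ≤ A.indicator (1 : S → ℝ) s :=
  Set.indicator_nonneg (fun _ _ => zero_le_one) s

theorem indicator_one_le_one (A : Set S) (s : S) : A.indicator (1 : S → ℝ) s ≤ 1 :=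
  Set.indicator_le_self' (fun _ _ => zero_le_one) s

theorem playCount_nonneg (A : Set S) {t : ℕ} (h : Fin t → S × ℝ) : 0 ≤ playCount A h :=
  Finset.sum_nonneg fun _ _ => indicator_one_nonneg A _

theorem playCount_le (A : Set S) {t : ℕ} (h : Fin t → S × ℝ) : playCount A h ≤ t := by
  refine (Finset.sum_le_sum fun _ _ => indicator_one_le_one A _).trans ?_
  simp

theorem playCount_snoc (A : Set S) {t : ℕ} (h : Fin t → S × ℝ) (x : S × ℝ) :
    playCount A (Fin.snoc (α := fun _ => S × ℝ) h x : Fin (t + 1) → S × ℝ) =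
      playCount A h + A.indicator 1 x.1 := by
  simp [playCount, Fin.sum_univ_castSucc]

theorem rewardSum_snoc (A : Set S) {t : ℕ} (h : Fin t → S × ℝ) (x : S × ℝ) :
    rewardSum A (Fin.snoc (α := fun _ => S × ℝ) h x : Fin (t + 1) → S × ℝ) =
      rewardSum A h + A.indicator 1 x.1 * x.2 := by
  simp [rewardSum, Fin.sum_univ_castSucc]

/-- Likelihood ratio between the bandit with mean reward `δ` on `A` and the bandit without
signal. -/
theorem lintegral_historyLaw_eq (Q : Matrix (Fin N) (Fin N) ℝ) {α₀ α : Fin N → ℝ} {R : ℝ}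
    (hR : 0 < R) (π : Policy S) {A : Set S} (hA : MeasurableSet A) {δ : ℝ}
    (h₀ : ∀ s : S, probeReward Q α₀ s = 0)
    (hα : ∀ s : S, probeReward Q α s = δ * A.indicator 1 s) (t : ℕ)
    {F : (Fin t → S × ℝ) → ℝ≥0∞} (hF : Measurable F) :
    ∫⁻ h, F h ∂historyLaw Q α R π t =
      ∫⁻ h, ENNReal.ofReal (Real.exp (δ / R ^ 2 * rewardSum A h -
        δ ^ 2 / (2 * R ^ 2) * playCount A h)) * F h ∂historyLaw Q α₀ R π t := by
  induction t with
  | zero => simp [historyLaw, rewardSum, playCount]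
  | succ t ih =>
    have hv : Real.toNNReal (R ^ 2) ≠ 0 := by
      rw [Ne, Real.toNNReal_eq_zero, not_le]; positivity
    have hv' : ((Real.toNNReal (R ^ 2) : ℝ≥0) : ℝ) = R ^ 2 := Real.coe_toNNReal _ (sq_nonneg R)
    have hG : Measurable fun h => ENNReal.ofReal (Real.exp (δ / R ^ 2 * rewardSum A h -
        δ ^ 2 / (2 * R ^ 2) * playCount A h)) * F h := by
      have := measurable_rewardSum hA (t + 1)
      have := measurable_playCount hA (t + 1)
      fun_prop
    -- The policy kernel is the same under both laws, so only the Gaussian reward contributes a new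
    -- factor to the ratio.
    rw [lintegral_historyLaw_succ _ _ _ _ _ hF, lintegral_historyLaw_succ _ _ _ _ _ hG, ih]
    · refine lintegral_congr fun h => ?_
      rw [← lintegral_const_mul' _ _ ENNReal.ofReal_ne_top]
      refine lintegral_congr fun s => ?_
      have hFs : Measurable fun r : ℝ => F (Fin.snoc (α := fun _ => S × ℝ) h (s, r)) :=
        hF.comp ((measurable_snoc t).comp (measurable_prodMk_left.comp measurable_prodMk_left))
      rw [lintegral_gaussianReal_eq hv _ hFs, ← lintegral_const_mul' _ _ ENNReal.ofReal_ne_top, h₀]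
      refine lintegral_congr fun r => ?_
      rw [← mul_assoc, ← ENNReal.ofReal_mul (Real.exp_nonneg _), ← Real.exp_add, rewardSum_snoc,
        playCount_snoc, hα, hv']
      congr 3
      by_cases hs : s ∈ A
      · simp [hs]
        ring
      · simp [hs]
    · have := π.isMarkov t
      have hκ : Measurable fun p : (Fin t → S × ℝ) × S =>
          ∫⁻ r, F (Fin.snoc (α := fun _ => S × ℝ) p.1 (p.2, r)) ∂observation Q α R S p.2 := by
        have := Measurable.lintegral_kernel_prod_right
          (κ := Kernel.prodMkLeft (Fin t → S × ℝ) (observation Q α R S))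
          (f := fun p r => F (Fin.snoc (α := fun _ => S × ℝ) p.1 (p.2, r)))
          (hF.comp ((measurable_snoc t).comp
            (measurable_fst.fst.prodMk (measurable_fst.snd.prodMk measurable_snd))))
        exact this
      have := Measurable.lintegral_kernel_prod_right (κ := π.act t)
        (f := fun h s => ∫⁻ r, F (Fin.snoc (α := fun _ => S × ℝ) h (s, r)) ∂observation Q α R S s) hκ
      simpa only [observation_apply] using this

/-- Without signal, the sum of the rewards observed on `A` has variance `R²` per play. -/
theorem lintegral_rewardSum_sq (Q : Matrix (Fin N) (Fin N) ℝ) {α₀ : Fin N → ℝ} (R : ℝ)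
    (π : Policy S) {A : Set S} (hA : MeasurableSet A)
    (h₀ : ∀ s : S, probeReward Q α₀ s = 0) (t : ℕ) :
    ∫⁻ h, ENNReal.ofReal (rewardSum A h ^ 2) ∂historyLaw Q α₀ R π t =
      ENNReal.ofReal (R ^ 2) * ∫⁻ h, ENNReal.ofReal (playCount A h) ∂historyLaw Q α₀ R π t := by
  induction t with
  | zero => simp [historyLaw, rewardSum, playCount]
  | succ t ih =>
    have := π.isMarkov t
    have hi : Measurable (A.indicator (1 : S → ℝ)) := measurable_one.indicator hA
    have hv' : ((Real.toNNReal (R ^ 2) : ℝ≥0) : ℝ) = R ^ 2 := Real.coe_toNNReal _ (sq_nonneg R)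
    rw [lintegral_historyLaw_succ _ _ _ _ _ ((measurable_rewardSum hA _).pow_const 2).ennreal_ofReal,
      lintegral_historyLaw_succ _ _ _ _ _ (measurable_playCount hA _).ennreal_ofReal]
    have e1 : ∀ (h : Fin t → S × ℝ) (s : S), ∫⁻ r, ENNReal.ofReal
        (rewardSum A (Fin.snoc (α := fun _ => S × ℝ) h (s, r) : Fin (t + 1) → S × ℝ) ^ 2)
        ∂gaussianReal (probeReward Q α₀ s) (Real.toNNReal (R ^ 2)) =
        ENNReal.ofReal (rewardSum A h ^ 2) +
          ENNReal.ofReal (R ^ 2) * ENNReal.ofReal (A.indicator 1 s) := by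
      intro h s
      -- Fresh noise is centered, so the cross term vanishes and the second moment grows by `R ^ 2`
      -- exactly when the probe lies in `A`.
      simp only [rewardSum_snoc, h₀, lintegral_sq_add_mul_gaussianReal, hv']
      rw [← ENNReal.ofReal_mul (sq_nonneg R)]
      by_cases hs : s ∈ A <;> simp [hs]
    have e2 : ∀ (h : Fin t → S × ℝ) (s : S), ∫⁻ r, ENNReal.ofReal
        (playCount A (Fin.snoc (α := fun _ => S × ℝ) h (s, r) : Fin (t + 1) → S × ℝ))
        ∂gaussianReal (probeReward Q α₀ s) (Real.toNNReal (R ^ 2)) =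
        ENNReal.ofReal (playCount A h) + ENNReal.ofReal (A.indicator 1 s) := by
      intro h s
      simp only [playCount_snoc, lintegral_const, measure_univ, mul_one]
      exact ENNReal.ofReal_add (playCount_nonneg A h) (indicator_one_nonneg A s)
    simp only [e1, e2]
    simp only [lintegral_add_left measurable_const, lintegral_const, measure_univ, mul_one,
      lintegral_const_mul' _ _ ENNReal.ofReal_ne_top]
    rw [lintegral_add_left ((measurable_rewardSum hA _).pow_const 2).ennreal_ofReal,
      lintegral_add_left (measurable_playCount hA _).ennreal_ofReal, ih,
      lintegral_const_mul' _ _ ENNReal.ofReal_ne_top, mul_add]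

/-- A policy cannot distinguish a small positive signal on `A` from a small negative one. -/
theorem two_point_bound (Q : Matrix (Fin N) (Fin N) ℝ) {α₀ α₁ α₂ : Fin N → ℝ} {R : ℝ}
    (hR : 0 < R) (π : Policy S) {A : Set S} (hA : MeasurableSet A) {δ : ℝ}
    (h₀ : ∀ s : S, probeReward Q α₀ s = 0)
    (h₁ : ∀ s : S, probeReward Q α₁ s = δ * A.indicator 1 s)
    (h₂ : ∀ s : S, probeReward Q α₂ s = -δ * A.indicator 1 s) (T : ℕ) :
    ENNReal.ofReal (T / 2) ≤
      ∫⁻ h, ENNReal.ofReal (T - playCount A h) ∂historyLaw Q α₁ R π T +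
      ∫⁻ h, ENNReal.ofReal (playCount A h) ∂historyLaw Q α₂ R π T +
      ENNReal.ofReal (T * (δ ^ 2 / R ^ 2)) *
        ∫⁻ h, ENNReal.ofReal (playCount A h) ∂historyLaw Q α₀ R π T := by
  have mN := measurable_playCount hA T
  have mM := measurable_rewardSum hA T
  set P := historyLaw Q α₀ R π T
  -- Half of the penalty is traded for the second moment of the reward sum; the other half pays for
  -- the quadratic term of the log-likelihood. The claim then holds pointwise in the history.
  have hV : ENNReal.ofReal (T * (δ ^ 2 / R ^ 2)) * ∫⁻ h, ENNReal.ofReal (playCount A h) ∂P =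
      ∫⁻ h, ENNReal.ofReal (T / 2 * (δ / R ^ 2) ^ 2) * ENNReal.ofReal (rewardSum A h ^ 2) ∂P +
      ∫⁻ h, ENNReal.ofReal (T * (δ ^ 2 / (2 * R ^ 2))) * ENNReal.ofReal (playCount A h) ∂P := by
    rw [lintegral_const_mul' _ _ ENNReal.ofReal_ne_top,
      lintegral_const_mul' _ _ ENNReal.ofReal_ne_top, lintegral_rewardSum_sq Q R π hA h₀,
      ← mul_assoc, ← ENNReal.ofReal_mul (by positivity), ← add_mul,
      ← ENNReal.ofReal_add (by positivity) (by positivity)]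
    congr 2
    field_simp
    ring
  rw [hV, lintegral_historyLaw_eq Q hR π hA h₀ h₁ T (by fun_prop),
    lintegral_historyLaw_eq Q hR π hA h₀ h₂ T (by fun_prop),
    ← lintegral_add_left (by fun_prop), ← lintegral_add_left (by fun_prop),
    ← lintegral_add_left (by fun_prop)]
  calc ENNReal.ofReal (T / 2) = ∫⁻ _, ENNReal.ofReal (T / 2) ∂P := by simp [P]
    _ ≤ _ := lintegral_mono fun h => ?_
  have n0 := playCount_nonneg A h
  have n1 := playCount_le A h
  generalize playCount A h = n at *
  generalize rewardSum A h = M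
  have n2 : (0 : ℝ) ≤ T - n := by linarith
  rw [← ENNReal.ofReal_mul (Real.exp_nonneg _), ← ENNReal.ofReal_mul (Real.exp_nonneg _),
    ← ENNReal.ofReal_mul (by positivity), ← ENNReal.ofReal_mul (by positivity),
    ← ENNReal.ofReal_add (by positivity) (by positivity),
    ← ENNReal.ofReal_add (by positivity) (by positivity),
    ← ENNReal.ofReal_add (by positivity) (by positivity)]
  refine ENNReal.ofReal_le_ofReal ?_
  have e1 := mul_le_mul_of_nonneg_right
    (Real.add_one_le_exp (δ / R ^ 2 * M - δ ^ 2 / (2 * R ^ 2) * n)) n2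
  have e2 := mul_le_mul_of_nonneg_right
    (Real.add_one_le_exp (-δ / R ^ 2 * M - (-δ) ^ 2 / (2 * R ^ 2) * n)) n0
  refine le_trans ?_ (add_le_add_left (add_le_add e1 e2) _)
  rw [neg_sq, neg_div]
  generalize δ ^ 2 / (2 * R ^ 2) = w
  generalize δ / R ^ 2 = x
  -- After cancelling the terms in `w`, the difference of the two sides is half the sum of the two
  -- hinted products.
  nlinarith [mul_nonneg n0 (sq_nonneg (x * M - 1)), mul_nonneg n2 (sq_nonneg (x * M + 1))]

end ChangeOfMeasure

/-! ### From play counts to a minimax regret bound -/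

section Regret

variable {N : ℕ} {S : Set (Fin N → ℝ)}

theorem integrable_playCount {A : Set S} (hA : MeasurableSet A) (Q : Matrix (Fin N) (Fin N) ℝ)
    (α : Fin N → ℝ) (R : ℝ) (π : Policy S) (t : ℕ) :
    Integrable (playCount A) (historyLaw Q α R π t) :=
  Integrable.of_bound (measurable_playCount hA t).aestronglyMeasurable t <| ae_of_all _ fun h => by
    rw [Real.norm_of_nonneg (playCount_nonneg A h)]
    exact playCount_le A h

theorem expectedRegret_eq (Q : Matrix (Fin N) (Fin N) ℝ) {α : Fin N → ℝ} (R : ℝ) (π : Policy S)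
    (A : Set S) {δ b : ℝ} (hα : ∀ s : S, probeReward Q α s = δ * A.indicator 1 s)
    (hb : ⨆ s : S, probeReward Q α s = b) (T : ℕ) :
    expectedRegret Q α R π T = ∫ h, (T * b - δ * playCount A h) ∂historyLaw Q α R π T := by
  rw [expectedRegret, hb]
  congr 1
  ext h
  simp [hα, playCount, Finset.mul_sum]

theorem iSup_probeReward {Q : Matrix (Fin N) (Fin N) ℝ} {α : Fin N → ℝ} {A : Set S} {δ : ℝ}
    (hδ : 0 ≤ δ) (hA : A.Nonempty) (hα : ∀ s : S, probeReward Q α s = δ * A.indicator 1 s) :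
    ⨆ s : S, probeReward Q α s = δ := by
  obtain ⟨a, ha⟩ := hA
  suffices h : IsGreatest (Set.range fun s : S => probeReward Q α s) δ from h.csSup_eq
  refine ⟨⟨a, by simp [hα, ha]⟩, ?_⟩
  rintro _ ⟨s, rfl⟩
  simp only [hα]
  exact mul_le_of_le_one_right hδ (indicator_one_le_one A s)

/-- A probe outside `A` earns exactly `0`; this is where a reward-free alternative is needed. -/
theorem iSup_probeReward_neg {Q : Matrix (Fin N) (Fin N) ℝ} {α : Fin N → ℝ} {A : Set S} {δ : ℝ}
    (hδ : 0 ≤ δ) (hA : Aᶜ.Nonempty)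
    (hα : ∀ s : S, probeReward Q α s = -δ * A.indicator 1 s) :
    ⨆ s : S, probeReward Q α s = 0 := by
  obtain ⟨a, ha⟩ := hA
  have ha' : a ∉ A := ha
  suffices h : IsGreatest (Set.range fun s : S => probeReward Q α s) 0 from h.csSup_eq
  refine ⟨⟨a, by simp [hα, ha']⟩, ?_⟩
  rintro _ ⟨s, rfl⟩
  simp only [hα]
  nlinarith [indicator_one_nonneg A s]

/-- Under the positive signal each play outside `A` costs `δ`, under the negative one each play in
`A` does, so the regrets are `δ` times the integrals in `two_point_bound`. -/
theorem le_expectedRegret_add (Q : Matrix (Fin N) (Fin N) ℝ) {α₀ α₁ α₂ : Fin N → ℝ} {R : ℝ}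
    (hR : 0 < R) (π : Policy S) {A : Set S} (hA : MeasurableSet A) (hA₁ : A.Nonempty)
    (hA₂ : Aᶜ.Nonempty) {δ : ℝ} (hδ : 0 ≤ δ)
    (h₀ : ∀ s : S, probeReward Q α₀ s = 0)
    (h₁ : ∀ s : S, probeReward Q α₁ s = δ * A.indicator 1 s)
    (h₂ : ∀ s : S, probeReward Q α₂ s = -δ * A.indicator 1 s) (T : ℕ) :
    δ * (T / 2 - T * (δ ^ 2 / R ^ 2) * ∫ h, playCount A h ∂historyLaw Q α₀ R π T) ≤
      expectedRegret Q α₁ R π T + expectedRegret Q α₂ R π T := by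
  have key := two_point_bound Q hR π hA h₀ h₁ h₂ T
  have i₀ := integrable_playCount hA Q α₀ R π T
  have i₁ : Integrable (fun h => T - playCount A h) (historyLaw Q α₁ R π T) :=
    (integrable_const _).sub (integrable_playCount hA Q α₁ R π T)
  have i₂ := integrable_playCount hA Q α₂ R π T
  have n : ∀ h : Fin T → S × ℝ, 0 ≤ playCount A h := playCount_nonneg A
  have n' : ∀ h : Fin T → S × ℝ, 0 ≤ T - playCount A h := fun h => sub_nonneg.2 (playCount_le A h)
  have p₀ := integral_nonneg_of_ae (ae_of_all (historyLaw Q α₀ R π T) n)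
  have p₁ := integral_nonneg_of_ae (ae_of_all (historyLaw Q α₁ R π T) n')
  have p₂ := integral_nonneg_of_ae (ae_of_all (historyLaw Q α₂ R π T) n)
  rw [← ofReal_integral_eq_lintegral_ofReal i₀ (ae_of_all _ n),
    ← ofReal_integral_eq_lintegral_ofReal i₂ (ae_of_all _ n),
    ← ofReal_integral_eq_lintegral_ofReal i₁ (ae_of_all _ n'),
    ← ENNReal.ofReal_mul (by positivity), ← ENNReal.ofReal_add p₁ p₂,
    ← ENNReal.ofReal_add (by positivity) (by positivity),
    ENNReal.ofReal_le_ofReal_iff (by positivity)] at key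
  rw [expectedRegret_eq Q R π A h₁ (iSup_probeReward hδ hA₁ h₁),
    expectedRegret_eq Q R π A h₂ (iSup_probeReward_neg hδ hA₂ h₂)]
  have e₁ : ∫ h, (T * δ - δ * playCount A h) ∂historyLaw Q α₁ R π T =
      δ * ∫ h, (T - playCount A h) ∂historyLaw Q α₁ R π T := by
    rw [← integral_const_mul]
    congr 1; ext h; ring
  have e₂ : ∫ h, (T * 0 - -δ * playCount A h) ∂historyLaw Q α₂ R π T =
      δ * ∫ h, playCount A h ∂historyLaw Q α₂ R π T := by
    rw [← integral_const_mul]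
    congr 1; ext h; ring
  rw [e₁, e₂, ← mul_add]
  exact mul_le_mul_of_nonneg_left (by linarith) hδ

/-- Each step plays at most one of the disjoint groups. -/
theorem sum_integral_playCount_le {ι : Type*} [Fintype ι] {A : ι → Set S}
    (hA : ∀ i, MeasurableSet (A i)) (hdisj : Pairwise fun i j => Disjoint (A i) (A j))
    (Q : Matrix (Fin N) (Fin N) ℝ) (α : Fin N → ℝ) (R : ℝ) (π : Policy S) (T : ℕ) :
    ∑ i, ∫ h, playCount (A i) h ∂historyLaw Q α R π T ≤ T := by
  rw [← integral_finsetSum _ fun i _ => integrable_playCount (hA i) Q α R π T]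
  calc ∫ h, ∑ i, playCount (A i) h ∂historyLaw Q α R π T
      ≤ ∫ _, (T : ℝ) ∂historyLaw Q α R π T := by
        refine integral_mono
          (integrable_finsetSum _ fun i _ => integrable_playCount (hA i) Q α R π T)
          (integrable_const _) fun h => ?_
        have : ∑ i, playCount (A i) h = playCount (⋃ i, A i) h := by
          unfold playCount
          rw [Finset.sum_comm]
          refine Finset.sum_congr rfl fun j _ => ?_
          by_cases hx : ∃ i, (h j).1 ∈ A i
          · obtain ⟨i, hi⟩ := hx
            rw [Finset.sum_eq_single i, Set.indicator_of_mem hi,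
              Set.indicator_of_mem (Set.mem_iUnion_of_mem i hi)]
            · intro k _ hk
              exact Set.indicator_of_notMem
                (fun hk' => Set.disjoint_left.1 (hdisj hk) hk' hi) _
            · simp
          · push Not at hx
            rw [Set.indicator_of_notMem (by simpa using hx)]
            exact Finset.sum_eq_zero fun i _ => Set.indicator_of_notMem (hx i) _
        exact this ▸ playCount_le _ h
    _ = T := by simp

/-- Minimax lower bound for `K` disjoint groups of arms: some signal of size `R √(K / T) / 2`,
positive or negative, on one of the groups is costly for the policy. -/
theorem exists_le_expectedRegret {K T : ℕ} (hK : 0 < K) (hT : 0 < T)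
    (Q : Matrix (Fin N) (Fin N) ℝ) {R : ℝ} (hR : 0 < R) (π : Policy S) {A : Fin K → Set S}
    (hA : ∀ i, MeasurableSet (A i)) (hdisj : Pairwise fun i j => Disjoint (A i) (A j))
    (hA₁ : ∀ i, (A i).Nonempty) (hA₂ : ∀ i, (A i)ᶜ.Nonempty)
    {α₀ : Fin N → ℝ} {α : Fin K → ℝ → Fin N → ℝ}
    (h₀ : ∀ s : S, probeReward Q α₀ s = 0)
    (hα : ∀ i δ, ∀ s : S, probeReward Q (α i δ) s = δ * (A i).indicator 1 s) :
    ∃ i δ, δ ^ 2 = R ^ 2 * K / (4 * T) ∧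
      R * √(K * T) / 16 ≤ expectedRegret Q (α i δ) R π T := by
  have : Nonempty (Fin K) := ⟨⟨0, hK⟩⟩
  have hK' : (0 : ℝ) < K := by exact_mod_cast hK
  have hT' : (0 : ℝ) < T := by exact_mod_cast hT
  obtain ⟨i, -, hi⟩ : ∃ i ∈ Finset.univ,
      ∫ h, playCount (A i) h ∂historyLaw Q α₀ R π T ≤ T / K := by
    refine Finset.exists_le_of_sum_le Finset.univ_nonempty
      ((sum_integral_playCount_le hA hdisj Q α₀ R π T).trans ?_)
    simp only [Finset.sum_const, Finset.card_univ, Fintype.card_fin, nsmul_eq_mul]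
    rw [mul_div_cancel₀ _ hK'.ne']
  -- Chosen so that the penalty `T * (δ ^ 2 / R ^ 2) * (T / K)` equals `T / 4`, half of the main
  -- term `T / 2`.
  set δ : ℝ := R / 2 * √(K / T) with hδ
  have hδ0 : 0 ≤ δ := by positivity
  have hδ2 : δ ^ 2 = R ^ 2 * K / (4 * T) := by
    rw [hδ, mul_pow, Real.sq_sqrt (by positivity)]
    ring
  have hδT : δ * T = R * √(K * T) / 2 := by
    have : √(K * T : ℝ) = √(K / T) * T := by
      rw [show (K * T : ℝ) = K / T * T ^ 2 by field_simp, Real.sqrt_mul (by positivity),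
        Real.sqrt_sq hT'.le]
    rw [this, hδ]
    ring
  have key := le_expectedRegret_add Q hR π (hA i) (hA₁ i) (hA₂ i) hδ0 h₀ (hα i δ) (hα i (-δ)) T
  have hc : T * (δ ^ 2 / R ^ 2) * (T / K : ℝ) = T / 4 := by
    rw [hδ2]
    field_simp
  have hle : δ * (T / 4) ≤
      δ * (T / 2 - T * (δ ^ 2 / R ^ 2) * ∫ h, playCount (A i) h ∂historyLaw Q α₀ R π T) := by
    refine mul_le_mul_of_nonneg_left ?_ hδ0
    have := mul_le_mul_of_nonneg_left hi (show 0 ≤ T * (δ ^ 2 / R ^ 2) by positivity)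
    linarith
  -- The two regrets add up to at least `δ * T / 4 = R * √(K * T) / 8`, so one of them reaches half
  -- of that.
  by_cases h : R * √(K * T) / 16 ≤ expectedRegret Q (α i δ) R π T
  · exact ⟨i, δ, hδ2, h⟩
  · exact ⟨i, -δ, by rw [neg_sq, hδ2], by linarith⟩

end Regret

/-! ### The hard graph: Laplacian, spectrum, effective dimension -/

section CliqueGraph

/-- The disjoint union of `K` isolated nodes and a clique on `m` nodes. -/
def isolatedPlusClique (K m : ℕ) : SimpleGraph (Fin (K + m)) where
  Adj u v := u ≠ v ∧ K ≤ (u : ℕ) ∧ K ≤ (v : ℕ)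
  symm := ⟨fun _ _ h => ⟨h.1.symm, h.2.2, h.2.1⟩⟩
  loopless := ⟨fun _ h => h.1 rfl⟩

/-- The indicator function of the clique in `isolatedPlusClique K m`. -/
def cliqueIndicator (K m : ℕ) (u : Fin (K + m)) : ℝ := if K ≤ (u : ℕ) then 1 else 0

variable {K m : ℕ}

theorem sum_cliqueIndicator : ∑ u, cliqueIndicator K m u = m := by
  rw [Fin.sum_univ_add]
  simp [cliqueIndicator]

theorem cliqueIndicator_mul_self (u : Fin (K + m)) :
    cliqueIndicator K m u * cliqueIndicator K m u = cliqueIndicator K m u := by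
  simp [cliqueIndicator]

theorem laplacian_isolatedPlusClique :
    laplacian (isolatedPlusClique K m) = (m : ℝ) • Matrix.diagonal (cliqueIndicator K m) -
      Matrix.vecMulVec (cliqueIndicator K m) (cliqueIndicator K m) := by
  classical
  have hadj : (isolatedPlusClique K m).adjMatrix ℝ =
      Matrix.vecMulVec (cliqueIndicator K m) (cliqueIndicator K m) -
        Matrix.diagonal (cliqueIndicator K m) := by
    ext u v
    rw [SimpleGraph.adjMatrix_apply, Matrix.sub_apply, Matrix.vecMulVec_apply,
      Matrix.diagonal_apply]
    by_cases huv : u = v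
    · subst huv
      simp [cliqueIndicator_mul_self]
    · simp only [isolatedPlusClique, cliqueIndicator, huv]
      by_cases hu : K ≤ (u : ℕ) <;> by_cases hv : K ≤ (v : ℕ) <;> simp [hu, hv, huv]
  have hdeg : (isolatedPlusClique K m).degMatrix ℝ =
      ((m : ℝ) - 1) • Matrix.diagonal (cliqueIndicator K m) := by
    ext u v
    rw [SimpleGraph.degMatrix, Matrix.smul_apply, Matrix.diagonal_apply, Matrix.diagonal_apply]
    split_ifs with huv
    · have h : ((isolatedPlusClique K m).degree u : ℝ) =
          ∑ v, (isolatedPlusClique K m).adjMatrix ℝ u v := by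
        simp only [SimpleGraph.degree_eq_sum_if_adj, SimpleGraph.adjMatrix_apply]
      rw [h, hadj]
      simp only [Matrix.sub_apply, Matrix.vecMulVec_apply, Finset.sum_sub_distrib,
        ← Finset.mul_sum, sum_cliqueIndicator, Matrix.diagonal_apply, Finset.sum_ite_eq,
        Finset.mem_univ, if_true, smul_eq_mul]
      ring
    · simp
  unfold laplacian
  rw [SimpleGraph.lapMatrix]
  convert congrArg₂ (· - ·) hdeg hadj using 1
  rw [sub_smul, one_smul]
  abel

/-- On the clique the Laplacian is `m I - J` with `J` the all-ones matrix and `J² = m J`. The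
identity forces every eigenvalue to be `0` or `m`. -/
theorem laplacian_mul_self :
    laplacian (isolatedPlusClique K m) * laplacian (isolatedPlusClique K m) =
      (m : ℝ) • laplacian (isolatedPlusClique K m) := by
  rw [laplacian_isolatedPlusClique]
  set b := cliqueIndicator K m
  have hb : (fun i => b i * b i) = b := funext cliqueIndicator_mul_self
  have h1 : Matrix.diagonal b * Matrix.diagonal b = Matrix.diagonal b := by
    rw [Matrix.diagonal_mul_diagonal, hb]
  have h2 : Matrix.diagonal b * Matrix.vecMulVec b b = Matrix.vecMulVec b b := by
    ext i j
    rw [Matrix.diagonal_mul, Matrix.vecMulVec_apply, ← mul_assoc, cliqueIndicator_mul_self]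
  have h3 : Matrix.vecMulVec b b * Matrix.diagonal b = Matrix.vecMulVec b b := by
    ext i j
    rw [Matrix.mul_diagonal, Matrix.vecMulVec_apply, mul_assoc, cliqueIndicator_mul_self]
  have h4 : Matrix.vecMulVec b b * Matrix.vecMulVec b b = (m : ℝ) • Matrix.vecMulVec b b := by
    ext i j
    simp only [Matrix.mul_apply, Matrix.vecMulVec_apply, Matrix.smul_apply, smul_eq_mul]
    rw [← sum_cliqueIndicator (K := K), Finset.sum_mul]
    refine Finset.sum_congr rfl fun k _ => ?_
    linear_combination b i * b j * cliqueIndicator_mul_self k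
  simp only [sub_mul, mul_sub, Matrix.smul_mul, Matrix.mul_smul, h1, h2, h3, h4, smul_sub]
  abel

theorem trace_laplacian : (laplacian (isolatedPlusClique K m)).trace = (m : ℝ) * (m - 1) := by
  rw [laplacian_isolatedPlusClique, Matrix.trace_sub, Matrix.trace_smul, Matrix.trace_diagonal,
    Matrix.trace_vecMulVec, dotProduct]
  simp only [cliqueIndicator_mul_self, sum_cliqueIndicator, smul_eq_mul]
  ring

theorem LaplacianSpectrum.diagonal_ev {N : ℕ} {G : SimpleGraph (Fin N)} (s : LaplacianSpectrum G) :
    Matrix.diagonal s.ev = s.Qᵀ * laplacian G * s.Q := by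
  rw [s.laplacian_eq]
  calc Matrix.diagonal s.ev = s.Qᵀ * s.Q * Matrix.diagonal s.ev * (s.Qᵀ * s.Q) := by
        simp [s.Q_orthonormal]
    _ = _ := by simp only [Matrix.mul_assoc]

theorem LaplacianSpectrum.mul_transpose {N : ℕ} {G : SimpleGraph (Fin N)}
    (s : LaplacianSpectrum G) : s.Q * s.Qᵀ = 1 :=
  mul_eq_one_comm.1 s.Q_orthonormal

theorem ev_eq_zero_or (s : LaplacianSpectrum (isolatedPlusClique K m)) (k : Fin (K + m)) :
    s.ev k = 0 ∨ s.ev k = m := by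
  have h : Matrix.diagonal s.ev * Matrix.diagonal s.ev = (m : ℝ) • Matrix.diagonal s.ev := by
    rw [s.diagonal_ev]
    calc _ = s.Qᵀ * laplacian (isolatedPlusClique K m) * (s.Q * s.Qᵀ) *
          laplacian (isolatedPlusClique K m) * s.Q := by simp only [Matrix.mul_assoc]
      _ = _ := by
        rw [s.mul_transpose, Matrix.mul_one, Matrix.mul_assoc s.Qᵀ, laplacian_mul_self]
        simp
  have hk := congr_fun (congr_fun h k) k
  rw [Matrix.diagonal_mul_diagonal, Matrix.smul_apply, Matrix.diagonal_apply_eq,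
    Matrix.diagonal_apply_eq, smul_eq_mul] at hk
  rcases eq_or_ne (s.ev k) 0 with h0 | h0
  · exact Or.inl h0
  · exact Or.inr (mul_right_cancel₀ h0 hk)

theorem sum_ev (s : LaplacianSpectrum (isolatedPlusClique K m)) :
    ∑ k, s.ev k = (m : ℝ) * (m - 1) := by
  rw [← Matrix.trace_diagonal, s.diagonal_ev, Matrix.trace_mul_comm, ← Matrix.mul_assoc,
    s.mul_transpose, Matrix.one_mul, trace_laplacian]

/-- Since all eigenvalues are `0` or `m`, the trace `m (m - 1)` counts `m - 1` copies of `m`, and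
monotonicity puts them last. -/
theorem ev_eq (hm : 0 < m) (s : LaplacianSpectrum (isolatedPlusClique K m)) (k : Fin (K + m)) :
    s.ev k = if (k : ℕ) < K + 1 then 0 else (m : ℝ) := by
  classical
  have hm' : (m : ℝ) ≠ 0 := by exact_mod_cast hm.ne'
  set Z := Finset.univ.filter fun k => s.ev k = m with hZ
  have hcard : Z.card = m - 1 := by
    have h : ∑ k, s.ev k = Z.card * (m : ℝ) := by
      rw [← nsmul_eq_mul, ← Finset.sum_const, hZ, Finset.sum_filter]
      refine Finset.sum_congr rfl fun k _ => ?_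
      rcases ev_eq_zero_or s k with h | h <;> simp [h, hm'.symm]
    rw [sum_ev, mul_comm, mul_left_inj' hm', ← Nat.cast_pred hm] at h
    exact_mod_cast h.symm
  have hmono : ∀ i j, i ∈ Z → i ≤ j → j ∈ Z := by
    intro i j hi hij
    rw [hZ, Finset.mem_filter_univ] at hi ⊢
    have := s.ev_monotone hij
    have h0 : (0 : ℝ) < m := by exact_mod_cast hm
    rcases ev_eq_zero_or s j with h | h
    · linarith
    · exact h
  split_ifs with hk
  · refine (ev_eq_zero_or s k).resolve_right fun h => ?_
    have hsub : Finset.Ici k ⊆ Z := fun j hj =>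
      hmono k j (by simp [hZ, h]) (Finset.mem_Ici.1 hj)
    have := Finset.card_le_card hsub
    rw [Fin.card_Ici, hcard] at this
    omega
  · refine (ev_eq_zero_or s k).resolve_left fun h => ?_
    have hsub : Z ⊆ Finset.Ioi k := fun j hj => by
      rw [Finset.mem_Ioi]
      by_contra hjk
      have := hmono j k hj (not_lt.1 hjk)
      rw [hZ, Finset.mem_filter_univ, h] at this
      exact hm' this.symm
    have := Finset.card_le_card hsub
    rw [Fin.card_Ioi, hcard] at this
    omega

theorem isEffectiveDimension_isolatedPlusClique {T : ℕ} {lam : ℝ} (hm : 2 ≤ m) (hlam : 0 < lam)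
    (hle : (K : ℝ) * lam ≤ (T : ℝ) / Real.log ((T : ℝ) / lam + 1))
    (hlt : (T : ℝ) / Real.log ((T : ℝ) / lam + 1) < m)
    (s : LaplacianSpectrum (isolatedPlusClique K m)) :
    IsEffectiveDimension s.ev lam T (K + 1) := by
  have hK : (0 : ℝ) ≤ K := K.cast_nonneg
  have hm0 : (0 : ℝ) ≤ m := m.cast_nonneg
  refine ⟨⟨by omega, by omega, ?_, ?_⟩, ?_⟩
  · rw [ev_eq (by omega)]
    simpa using hle
  · rw [ev_eq (by omega)]
    simp only [lt_irrefl, if_false]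
    push_cast
    nlinarith
  -- Maximality: for `k ≥ K + 2` the eigenvalue in the left inequality is already `m`, so its left
  -- side exceeds the threshold.
  · rintro k ⟨_, hkN, hk, -⟩
    by_contra! hKk
    rw [ev_eq (by omega), if_neg (by simp only; omega)] at hk
    have : (K : ℝ) + 1 ≤ k - 1 := by
      have : K + 2 ≤ k := hKk
      have : (K : ℝ) + 2 ≤ k := by exact_mod_cast this
      linarith
    nlinarith

theorem isDisjointUnionOfCliques_isolatedPlusClique (hm : 0 < m) :
    IsDisjointUnionOfCliques (isolatedPlusClique K m) (K + 1) := by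
  have hreach : ∀ u v, (isolatedPlusClique K m).Reachable u v →
      u = v ∨ (isolatedPlusClique K m).Adj u v := by
    rintro u v ⟨p⟩
    induction p with
    | nil => exact Or.inl rfl
    | @cons a b c hab _ ih =>
      by_cases hac : a = c
      · exact Or.inl hac
      · refine Or.inr ?_
        rcases ih with rfl | ih
        · exact hab
        · exact ⟨hac, hab.2.1, ih.2.2⟩
  refine ⟨fun u v h huv => (hreach u v h).resolve_left huv, ?_⟩
  let f : Fin (K + 1) → (isolatedPlusClique K m).ConnectedComponent := fun i =>
    (isolatedPlusClique K m).connectedComponentMk ⟨i, by omega⟩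
  have hf : f.Bijective := by
    refine ⟨fun i j hij => ?_, fun c => ?_⟩
    · rcases hreach _ _ (SimpleGraph.ConnectedComponent.exact hij) with h | h
      · exact Fin.ext (by simpa using h)
      · have h1 := h.2.1
        have h2 := h.2.2
        exact Fin.ext (by simp only at h1 h2; omega)
    · induction c using SimpleGraph.ConnectedComponent.ind with
      | h v =>
        by_cases hv : (v : ℕ) < K + 1
        · exact ⟨⟨v, hv⟩, rfl⟩
        · refine ⟨Fin.last K, SimpleGraph.ConnectedComponent.sound ?_⟩
          refine SimpleGraph.Adj.reachable ⟨?_, ?_, ?_⟩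
          · rw [Ne, Fin.ext_iff]
            simp only [Fin.val_last]
            omega
          · simp
          · omega
  rw [← Nat.card_congr (Equiv.ofBijective f hf), Nat.card_fin]

/-- A signal of size `δ` on the isolated node `i`. -/
def signal (m : ℕ) (i : Fin K) (δ : ℝ) : Fin (K + m) → ℝ := Pi.single (Fin.castAdd m i) δ

theorem signal_eq_of_adj (i : Fin K) (δ : ℝ) {u v : Fin (K + m)}
    (h : (isolatedPlusClique K m).Adj u v) : signal m i δ u = signal m i δ v := by
  have hne : ∀ w : Fin (K + m), K ≤ (w : ℕ) → w ≠ Fin.castAdd m i := by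
    rintro w hw rfl
    simp only [Fin.val_castAdd] at hw
    omega
  rw [signal, Pi.single_eq_of_ne (hne u h.2.1), Pi.single_eq_of_ne (hne v h.2.2)]

theorem laplacian_mulVec_signal (i : Fin K) (δ : ℝ) :
    laplacian (isolatedPlusClique K m) *ᵥ signal m i δ = 0 := by
  ext u
  rw [signal, Matrix.mulVec_single, laplacian_isolatedPlusClique]
  have : cliqueIndicator K m (Fin.castAdd m i) = 0 := by simp [cliqueIndicator]
  by_cases hu : u = Fin.castAdd m i
  · simp [Matrix.vecMulVec_apply, hu, this]
  · simp [Matrix.vecMulVec_apply, Matrix.diagonal_apply_ne _ hu, this]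

/-! ### Reward functions in the kernel of the Laplacian -/

variable {N : ℕ} {G : SimpleGraph (Fin N)}

theorem LaplacianSpectrum.nodeReward_transpose_mulVec (s : LaplacianSpectrum G) (f : Fin N → ℝ) :
    nodeReward s.Q (s.Qᵀ *ᵥ f) = f := by
  rw [nodeReward, Matrix.mulVec_mulVec, s.mul_transpose, Matrix.one_mulVec]

/-- Coordinates of a kernel function live on zero eigenvalues, whatever basis `Q` picks inside the
eigenspaces. -/
theorem LaplacianSpectrum.ev_mul_eq_zero (s : LaplacianSpectrum G) {f : Fin N → ℝ}
    (hf : laplacian G *ᵥ f = 0) (k : Fin N) : s.ev k * (s.Qᵀ *ᵥ f) k = 0 := by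
  have h : Matrix.diagonal s.ev *ᵥ (s.Qᵀ *ᵥ f) = 0 := by
    rw [s.diagonal_ev, Matrix.mulVec_mulVec, Matrix.mul_assoc, s.mul_transpose, Matrix.mul_one,
      ← Matrix.mulVec_mulVec, hf, Matrix.mulVec_zero]
  rw [← Matrix.mulVec_diagonal, h, Pi.zero_apply]

theorem LaplacianSpectrum.lambdaNorm_eq (s : LaplacianSpectrum G) {f : Fin N → ℝ}
    (hf : laplacian G *ᵥ f = 0) (lam : ℝ) :
    lambdaNorm s.ev lam (s.Qᵀ *ᵥ f) = √(lam * (f ⬝ᵥ f)) := by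
  have h : Matrix.diagonal s.ev *ᵥ (s.Qᵀ *ᵥ f) = 0 :=
    funext fun k => by rw [Matrix.mulVec_diagonal, s.ev_mul_eq_zero hf, Pi.zero_apply]
  rw [lambdaNorm, Matrix.add_mulVec, h, zero_add, Matrix.smul_mulVec, Matrix.one_mulVec,
    dotProduct_smul, smul_eq_mul, Matrix.dotProduct_mulVec, Matrix.vecMul_transpose,
    Matrix.mulVec_mulVec, s.mul_transpose, Matrix.one_mulVec]

/-- A probe other than the one of the isolated node `i` collects none of the signal on `i`. -/
theorem dotProduct_signal {S : Set (Fin (K + m) → ℝ)}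
    (hS : IsProbeSet (isolatedPlusClique K m) S) (i : Fin K) (δ : ℝ) (s : S) :
    (s : Fin (K + m) → ℝ) ⬝ᵥ signal m i δ =
      δ * ({s : S | (s : Fin (K + m) → ℝ) = uniformProbe {Fin.castAdd m i}} : Set S).indicator
        1 s := by
  obtain ⟨s, hs⟩ := s
  rw [signal, dotProduct_single, mul_comm]
  congr 1
  by_cases h : s = uniformProbe {Fin.castAdd m i}
  · rw [Set.indicator_of_mem (by exact h)]
    simp [h, uniformProbe]
  · rw [Set.indicator_of_notMem (by exact h)]
    -- A probe that contains the isolated node has it as center with no neighbors, or as a neighbor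
    -- of the center, which is impossible.
    obtain ⟨j, B, hB, rfl⟩ := hS.2 s hs
    refine if_neg fun hi => h ?_
    rw [Finset.mem_insert] at hi
    rcases hi with rfl | hi
    · have : B = ∅ := Finset.eq_empty_of_forall_notMem fun v hv => by
        have := (hB v hv).2.1
        simp only [Fin.val_castAdd] at this
        omega
      rw [this, insert_empty_eq]
    · have := (hB _ hi).2.2
      simp only [Fin.val_castAdd] at this
      omega

theorem uniformProbe_singleton_injective {N : ℕ} :
    Function.Injective fun i : Fin N => uniformProbe {i} := by
  intro i j h
  have := congr_fun h i
  by_contra hij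
  simp [uniformProbe, hij] at this

end CliqueGraph

end SpectralBandit

/-! ### Choice of the clique size and of the constants -/

theorem proposition1 :
    ∃ κ : ℝ, 0 < κ ∧ ∀ (d T : ℕ) (R c lam : ℝ), 2 ≤ d → 1 ≤ T → 0 < R → 0 < c → 0 < lam →
      ((d : ℝ) - 1) * lam ≤ (T : ℝ) / Real.log ((T : ℝ) / lam + 1) →
      lam * d * R ^ 2 ≤ c ^ 2 * T →
      ∀ (spec : ∀ (N : ℕ) [NeZero N] (G : SimpleGraph (Fin N)), LaplacianSpectrum G)
        (S : ∀ (N : ℕ) [NeZero N], SimpleGraph (Fin N) → Set (Fin N → ℝ))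
        (_ : ∀ (N : ℕ) [NeZero N] (G : SimpleGraph (Fin N)), IsProbeSet G (S N G))
        (π : ∀ (N : ℕ) [NeZero N] (G : SimpleGraph (Fin N)), Policy (S N G)),
      ∃ (N : ℕ) (_ : NeZero N) (G : SimpleGraph (Fin N)) (α : Fin N → ℝ),
        IsEffectiveDimension (spec N G).ev lam T d ∧
        IsDisjointUnionOfCliques G d ∧
        (∀ i : Fin N, d ≤ (i : ℕ) → α i = 0) ∧
        (∀ u v, G.Adj u v → nodeReward (spec N G).Q α u = nodeReward (spec N G).Q α v) ∧
        lambdaNorm (spec N G).ev lam α ≤ c ∧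
        κ * R * √((d : ℝ) * T) ≤ expectedRegret (spec N G).Q α R (π N G) T := by
  refine ⟨1 / 32, by norm_num, ?_⟩
  intro d T R c lam hd hT hR hc hlam hle hsmooth spec S hS π
  obtain ⟨K, rfl⟩ : ∃ K, d = K + 1 := ⟨d - 1, by omega⟩
  have hK : 1 ≤ K := by omega
  obtain ⟨m₀, hm₀⟩ := exists_nat_gt ((T : ℝ) / Real.log ((T : ℝ) / lam + 1))
  obtain ⟨m, hm, hXm⟩ : ∃ m : ℕ, 2 ≤ m ∧ (T : ℝ) / Real.log ((T : ℝ) / lam + 1) < m :=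
    ⟨m₀ + 2, by omega, hm₀.trans_le (by push_cast; linarith)⟩
  have hN : NeZero (K + m) := ⟨by omega⟩
  have hK' : (1 : ℝ) ≤ K := by exact_mod_cast hK
  have hT' : (1 : ℝ) ≤ T := by exact_mod_cast hT
  have hP := hS (K + m) (isolatedPlusClique K m)
  set Ω := S (K + m) (isolatedPlusClique K m)
  set sp := spec (K + m) (isolatedPlusClique K m)
  let A : Fin K → Set Ω := fun i =>
    {s | (s : Fin (K + m) → ℝ) = uniformProbe {Fin.castAdd m i}}
  obtain ⟨i, δ, hδ, hreg⟩ := exists_le_expectedRegret (A := A) (α₀ := 0)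
    (α := fun i δ => sp.Qᵀ *ᵥ signal m i δ) hK hT sp.Q hR (π (K + m) (isolatedPlusClique K m))
    (fun i => measurable_subtype_coe (measurableSet_singleton _))
    (fun i j hij => Set.disjoint_left.2 fun s hi hj => hij <| Fin.castAdd_injective K m <|
      uniformProbe_singleton_injective (hi.symm.trans hj))
    (fun i => ⟨⟨_, hP.1 (Fin.castAdd m i)⟩, rfl⟩)
    -- The probe of a clique node is the alternative that never sees the signal.
    (fun i => ⟨⟨_, hP.1 (Fin.natAdd K ⟨0, by omega⟩)⟩, fun h => by
      have := uniformProbe_singleton_injective h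
      simp only [Fin.ext_iff, Fin.val_natAdd, Fin.val_castAdd] at this
      omega⟩)
    (fun s => by simp [probeReward, nodeReward])
    (fun i δ s => by
      rw [probeReward, sp.nodeReward_transpose_mulVec]
      exact dotProduct_signal hP i δ s)
  have hker := laplacian_mulVec_signal (m := m) i δ
  refine ⟨K + m, hN, isolatedPlusClique K m, sp.Qᵀ *ᵥ signal m i δ,
    isEffectiveDimension_isolatedPlusClique hm hlam (by simpa using hle) hXm sp,
    isDisjointUnionOfCliques_isolatedPlusClique (by omega), ?_, ?_, ?_, ?_⟩
  · intro k hk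
    have h := sp.ev_mul_eq_zero hker k
    rw [ev_eq (by omega), if_neg (by omega)] at h
    exact (mul_eq_zero.1 h).resolve_left (by exact_mod_cast (show m ≠ 0 by omega))
  · intro u v huv
    rw [sp.nodeReward_transpose_mulVec]
    exact signal_eq_of_adj i δ huv
  · rw [sp.lambdaNorm_eq hker, Real.sqrt_le_left hc.le]
    have : signal m i δ ⬝ᵥ signal m i δ = R ^ 2 * K / (4 * T) := by
      rw [← hδ, signal, dotProduct_single, Pi.single_eq_same, sq]
    rw [this, ← mul_div_assoc, div_le_iff₀ (by positivity)]
    push_cast at hsmooth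
    have : 0 < lam * R ^ 2 := by positivity
    nlinarith [mul_pos (pow_pos hc 2) (zero_lt_one.trans_le hT')]
  · refine le_trans ?_ hreg
    -- `K + 1 ≤ 4 * K` because `K ≥ 1`; the factor `2` turns `1 / 16` into `1 / 32`.
    have : √(((K + 1 : ℕ) : ℝ) * T) ≤ 2 * √(K * T : ℝ) := by
      rw [Real.sqrt_le_left (by positivity), mul_pow, Real.sq_sqrt (by positivity)]
      push_cast
      nlinarith
    nlinarith
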